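/- Let $k\ge 2$ and $n\ge 1$ be integers. Let $T_k^n$ be the perfect $k$-ary tree of depth $n$, that is, the finite connected acyclic graph with $k^n$ leaves having a vertex (the root) of degree $k$ whose distance to every leaf is $n$, all other internal vertices having degree $k+1$. For a finite simple graph $G$ and an integer $d\ge 1$, a (not necessarily proper) coloring of the vertices of $G$ with colors from a palette of $d$ colors (not all of which have to be used) is called $d$-distinguishing if the identity is the only automorphism of $G$ that maps every color class to itself. The $d$-paint cost $\rho^d(G)$ is the minimum size of the complement of a color class over all $d$-distinguishing colorings of $G$. Then $T_k^n$ has a $(k+1)$-distinguishing coloring, and $$\rho^{k+1}(T_k^n)=\begin{cases} k-1 & \text{if } n=1,\\ k(k-1) & \text{if } n=2,\\ (k-1)(k^2+1)k^{n-3} & \text{if } n\ge 3.\end{cases}$$ -/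

import Mathlib

namespace SimpleGraph

/-- A perfect `k`-ary tree of depth `n`: a connected acyclic graph with `k ^ n` leaves
(vertices of degree one) having a vertex (the root) of degree `k` whose distance to every leaf
is `n`, all other internal (non-leaf) vertices having degree `k + 1`. -/
structure IsPerfectKaryTree {V : Type*} [Fintype V] (G : SimpleGraph V) [DecidableRel G.Adj]
    (k n : ℕ) : Prop where
  isTree : G.IsTree
  card_leaves : (Finset.univ.filter fun v : V => G.degree v = 1).card = k ^ n
  exists_root : ∃ r : V, G.degree r = k ∧
    (∀ v : V, G.degree v = 1 → G.dist r v = n) ∧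
    (∀ v : V, v ≠ r → G.degree v ≠ 1 → G.degree v = k + 1)

/-- A vertex coloring is distinguishing if the only automorphism of the graph that maps every
color class to itself is the identity. (The coloring need not be proper.) -/
def IsDistinguishing {V C : Type*} (G : SimpleGraph V) (c : V → C) : Prop :=
  ∀ φ : G ≃g G, (∀ v : V, c (φ v) = c v) → ∀ v : V, φ v = v

/-- The `d`-paint cost: the minimum size of the complement of a color class over all
distinguishing colorings with colors from a palette of `d` colors (not all of which have to be
used). It is `0` by convention if there is no such coloring, so that a positive value always
means that the minimum is attained. -/
noncomputable def paintCost {V : Type*} [Fintype V] (G : SimpleGraph V) (d : ℕ) : ℕ :=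
  sInf {m : ℕ | ∃ c : V → Fin d, G.IsDistinguishing c ∧
    ∃ i : Fin d, m = (Finset.univ.filter fun v : V => c v ≠ i).card}

end SimpleGraph

/-!
# Paint cost of perfect trees

A colored rooted tree is described up to isomorphism by its *code*: the color of the root together
with the multiset of the codes of its principal subtrees. If two sibling subtrees have the same
code, exchanging them preserves the coloring; if no two have, a color-preserving automorphism fixes
the root and then, level by level, every vertex. So a coloring is distinguishing exactly if its code
is *good*, that is, sibling codes are always distinct
(`KaryVertex.good_code_of_distinguishing`, `KaryVertex.distinguishing_of_good_code`). Every good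
code is realised (`KaryVertex.exists_code_eq`), so the paint cost is the least cost of a good code,
where the cost counts the vertices not colored by a fixed color `i₀`
(`SimpleGraph.IsPerfectKaryTree.paintCost_eq`). The graph `G` enters only through an isomorphism
with a model tree whose vertices are addresses
(`SimpleGraph.IsPerfectKaryTree.exists_equiv`); its root is the only vertex of degree `k`.

The least costs are found by induction on the depth, keeping track of how many codes attain them.
In a star the `k` leaves have distinct colors, so the least cost is `k - 1`; it is attained by
exactly `k` codes, one for each color other than `i₀` that is absent from the leaves. At depth two
all `k` of them can be used, for a cost of `k * (k - 1)`, but then the code is unique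
(`TreeCode.eq_allStars`). Hence at depth three at most one of the `k` subtrees has cost
`k * (k - 1)`, the others cost at least one more (`TreeCode.mul_add_le_cost`), and this bound is
attained by more than `k` codes (`TreeCode.many_three`). From then on there are always enough codes
of least cost, and the least cost is multiplied by `k` with each level
(`TreeCode.mul_le_cost`, `TreeCode.Many.succ`).
-/

/-! ### The model tree and its symmetries -/

/-- Vertices of the perfect `k`-ary tree of depth `m`, as addresses: either the root, or a
vertex of the `i`-th of the `k` principal subtrees, which are perfect of depth one less. -/
inductive KaryVertex (k : ℕ) : ℕ → Type
  | root {m : ℕ} : KaryVertex k m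
  | child {m : ℕ} (i : Fin k) (x : KaryVertex k m) : KaryVertex k (m + 1)

namespace KaryVertex

variable {k : ℕ} {C : Type}

/-- `Parent x y` says that `x` is the parent of `y`. -/
inductive Parent : ∀ {m : ℕ}, KaryVertex k m → KaryVertex k m → Prop
  | top {m : ℕ} (i : Fin k) : Parent (m := m + 1) root (child i root)
  | step {m : ℕ} (i : Fin k) {x y : KaryVertex k m} (h : Parent x y) :
      Parent (child i x) (child i y)

theorem not_parent_root {m : ℕ} (x : KaryVertex k m) : ¬ Parent x root := by
  intro h; cases h

theorem parent_child_child {m : ℕ} {i j : Fin k} {x y : KaryVertex k m} :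
    Parent (child i x) (child j y) ↔ i = j ∧ Parent x y := by
  constructor
  · intro h; cases h with
    | step _ h => exact ⟨rfl, h⟩
  · rintro ⟨rfl, h⟩; exact .step _ h

theorem parent_root_child {m : ℕ} {j : Fin k} {y : KaryVertex k m} :
    Parent root (child j y) ↔ y = root := by
  constructor
  · intro h; cases h; rfl
  · rintro rfl; exact .top _

theorem exists_parent {m : ℕ} (x : KaryVertex k m) : x ≠ root → ∃ y, Parent y x := by
  induction x with
  | root => intro h; exact absurd rfl h
  | child i x ih =>
    intro _
    by_cases hx : x = root
    · subst hx; exact ⟨root, .top i⟩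
    · obtain ⟨y, hy⟩ := ih hx
      exact ⟨child i y, .step i hy⟩

theorem parent_induction {m : ℕ} {p : KaryVertex k m → Prop} (h0 : p root)
    (h1 : ∀ x y, Parent x y → p x → p y) (x : KaryVertex k m) : p x := by
  induction x with
  | root => exact h0
  | child i x ih =>
    exact ih (p := fun z => p (child i z)) (h1 _ _ (.top i) h0) fun a b hab ha =>
      h1 _ _ (.step i hab) ha

/-- The vertices of a tree of positive depth are the root and those of the `k` principal
subtrees. -/
def succEquiv (k m : ℕ) : KaryVertex k (m + 1) ≃ Option (Fin k × KaryVertex k m) where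
  toFun x := match x with
    | root => none
    | child i x => some (i, x)
  invFun x := match x with
    | none => root
    | some (i, x) => child i x
  left_inv x := by cases x <;> rfl
  right_inv x := by rcases x with _ | ⟨i, x⟩ <;> rfl

instance instUniqueZero : Unique (KaryVertex k 0) where
  default := root
  uniq x := by cases x; rfl

instance instFinite (m : ℕ) : Finite (KaryVertex k m) := by
  induction m with
  | zero => infer_instance
  | succ m ih => exact Finite.of_equiv _ (succEquiv k m).symm

noncomputable instance instFintype (m : ℕ) : Fintype (KaryVertex k m) := Fintype.ofFinite _

/-- A permutation of the vertices that preserves and reflects the parent relation, that is, an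
automorphism of the rooted tree. -/
def IsSymmetry {m : ℕ} (e : Equiv.Perm (KaryVertex k m)) : Prop :=
  ∀ x y, Parent (e x) (e y) ↔ Parent x y

theorem IsSymmetry.symm {m : ℕ} {e : Equiv.Perm (KaryVertex k m)} (he : IsSymmetry e) :
    IsSymmetry e.symm := by
  intro x y
  rw [← he]; simp

theorem IsSymmetry.apply_root {m : ℕ} {e : Equiv.Perm (KaryVertex k m)} (he : IsSymmetry e) :
    e root = root := by
  by_contra h
  obtain ⟨y, hy⟩ := exists_parent _ h
  obtain ⟨z, rfl⟩ := e.surjective y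
  exact not_parent_root _ ((he _ _).1 hy)

/-- Automorphisms of the principal subtrees, composed with a permutation of these subtrees,
give an automorphism of the whole tree. -/
theorem exists_symmetry {m : ℕ} (σ : Equiv.Perm (Fin k))
    (e : Fin k → Equiv.Perm (KaryVertex k m)) (he : ∀ i, IsSymmetry (e i)) :
    ∃ f : Equiv.Perm (KaryVertex k (m + 1)), IsSymmetry f ∧ f root = root ∧
      ∀ i x, f (child i x) = child (σ i) (e i x) := by
  let g : KaryVertex k (m + 1) → KaryVertex k (m + 1) := fun x => match x with
    | root => root
    | child i x => child (σ i) (e i x)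
  have hg : Function.Injective g := by
    intro x y hxy
    cases x with
    | root => cases y with
      | root => rfl
      | child j y => simp [g] at hxy
    | child i x => cases y with
      | root => simp [g] at hxy
      | child j y =>
        simp only [g, child.injEq, EmbeddingLike.apply_eq_iff_eq] at hxy
        obtain ⟨rfl, h⟩ := hxy
        simpa using h
  refine ⟨Equiv.ofBijective g (Finite.injective_iff_bijective.1 hg), ?_, rfl, fun _ _ => rfl⟩
  intro x y
  change Parent (g x) (g y) ↔ Parent x y
  cases y with
  | root => exact iff_of_false (not_parent_root _) (not_parent_root _)
  | child j y => cases x with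
    | root =>
      change Parent root (child (σ j) (e j y)) ↔ _
      rw [parent_root_child, parent_root_child]
      constructor
      · intro h
        rw [← (he j).apply_root] at h
        exact (e j).injective h
      · rintro rfl; exact (he j).apply_root
    | child i x =>
      change Parent (child (σ i) (e i x)) (child (σ j) (e j y)) ↔ _
      rw [parent_child_child, parent_child_child, σ.injective.eq_iff]
      constructor
      · rintro ⟨rfl, h⟩; exact ⟨rfl, (he i _ _).1 h⟩
      · rintro ⟨rfl, h⟩; exact ⟨rfl, (he i _ _).2 h⟩

/-- Every automorphism of the rooted tree arises as in `exists_symmetry`. -/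
theorem IsSymmetry.decompose {m : ℕ} {f : Equiv.Perm (KaryVertex k (m + 1))}
    (hf : IsSymmetry f) :
    ∃ (σ : Equiv.Perm (Fin k)) (e : Fin k → Equiv.Perm (KaryVertex k m)),
      (∀ i, IsSymmetry (e i)) ∧ ∀ i x, f (child i x) = child (σ i) (e i x) := by
  have h0 : ∀ i, ∃ j, f (child i root) = child j root := by
    intro i
    have h := (hf root (child i root)).2 (.top i)
    rw [hf.apply_root] at h
    cases hx : f (child i root) with
    | root => rw [hx] at h; exact absurd h (not_parent_root _)
    | child j y => rw [hx, parent_root_child] at h; exact ⟨j, by rw [h]⟩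
  choose s hs using h0
  have hsinj : Function.Injective s := by
    intro i j hij
    have : f (child i root) = f (child j root) := by rw [hs, hs, hij]
    simpa using this
  -- leaving the root aside, parents and children lie in the same principal subtree
  have h1 : ∀ i x, ∃ y, f (child i x) = child (s i) y := by
    intro i x
    induction x using parent_induction with
    | h0 => exact ⟨_, hs i⟩
    | h1 x y hxy ih =>
      obtain ⟨z, hz⟩ := ih
      have h := (hf _ _).2 (Parent.step i hxy)
      rw [hz] at h
      cases hy : f (child i y) with
      | root => rw [hy] at h; exact absurd h (not_parent_root _)
      | child j w => rw [hy, parent_child_child] at h; exact ⟨w, by rw [h.1]⟩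
  choose g hg using h1
  have hginj : ∀ i, Function.Injective (g i) := by
    intro i x y hxy
    have : f (child i x) = f (child i y) := by rw [hg, hg, hxy]
    simpa using this
  refine ⟨Equiv.ofBijective s (Finite.injective_iff_bijective.1 hsinj),
    fun i => Equiv.ofBijective (g i) (Finite.injective_iff_bijective.1 (hginj i)), ?_, hg⟩
  intro i x y
  have h := hf (child i x) (child i y)
  rw [hg, hg, parent_child_child, parent_child_child] at h
  simpa using h

end KaryVertex

/-! ### Codes of colorings -/

/-- Codes of colored perfect trees of depth `m`: the color of the root, together with the
multiset of the codes of the principal subtrees. Two colorings of the same tree have equal codes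
exactly if some automorphism carries one to the other. -/
def TreeCode (C : Type) : ℕ → Type
  | 0 => C
  | m + 1 => C × Multiset (TreeCode C m)

namespace TreeCode

variable {C : Type}

/-- The number of vertices whose color differs from `i₀`. -/
def cost [DecidableEq C] (i₀ : C) : ∀ m : ℕ, TreeCode C m → ℕ
  | 0, x => if (show C from x) = i₀ then 0 else 1
  | m + 1, x => (if x.1 = i₀ then 0 else 1) + (x.2.map (cost i₀ m)).sum

/-- Codes of perfect `k`-ary trees such that, at every internal vertex, the `k` principal subtrees have
pairwise distinct codes. -/
def Good (k : ℕ) : ∀ m : ℕ, TreeCode C m → Prop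
  | 0, _ => True
  | m + 1, x => x.2.Nodup ∧ Multiset.card x.2 = k ∧ ∀ y ∈ x.2, Good k m y

end TreeCode

namespace KaryVertex

variable {k : ℕ} {C : Type}

/-- The code of a coloring of the model tree. -/
def code : ∀ {m : ℕ}, (KaryVertex k m → C) → TreeCode C m
  | 0, c => c root
  | _ + 1, c => (c root, Finset.univ.val.map fun i => code fun x => c (child i x))

theorem code_snd {m : ℕ} (c : KaryVertex k (m + 1) → C) :
    (code c).2 = Finset.univ.val.map fun i => code fun x => c (child i x) := rfl

/-- Families with equal multisets of values differ by a permutation, because corresponding fibers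
have the same size. -/
theorem exists_perm_of_map_univ_eq {ι α : Type*} [Fintype ι] (g h : ι → α)
    (hgh : (Finset.univ : Finset ι).val.map g = (Finset.univ : Finset ι).val.map h) :
    ∃ σ : Equiv.Perm ι, ∀ i, h (σ i) = g i := by
  classical
  have key : ∀ a : α, Nonempty ({i // g i = a} ≃ {i // h i = a}) := by
    intro a
    rw [← Fintype.card_eq, Fintype.card_subtype, Fintype.card_subtype]
    have := congrArg (Multiset.count a) hgh
    rw [Multiset.count_map, Multiset.count_map] at this
    simpa only [Finset.card_def, Finset.filter_val, eq_comm] using this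
  exact ⟨Equiv.ofFiberEquiv fun a => (key a).some, fun i => Equiv.ofFiberEquiv_map _ i⟩

theorem exists_symmetry_of_code_eq {m : ℕ} (c c' : KaryVertex k m → C) (h : code c = code c') :
    ∃ e : Equiv.Perm (KaryVertex k m), IsSymmetry e ∧ ∀ x, c' (e x) = c x := by
  induction m with
  | zero =>
    refine ⟨Equiv.refl _, fun _ _ => Iff.rfl, fun x => ?_⟩
    cases x; exact h.symm
  | succ m ih =>
    obtain ⟨h0, h1⟩ := Prod.ext_iff.1 h
    rw [code_snd, code_snd] at h1
    obtain ⟨σ, hσ⟩ := exists_perm_of_map_univ_eq _ _ h1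
    choose e he hc using fun i => ih _ _ (hσ i).symm
    obtain ⟨f, hf, hr, hfc⟩ := exists_symmetry σ e he
    refine ⟨f, hf, fun x => ?_⟩
    cases x with
    | root => rw [hr]; exact h0.symm
    | child i x => rw [hfc]; exact hc i x

/-- Codes do not change under automorphisms, as these only permute the principal subtrees. -/
theorem code_eq_of_symmetry {m : ℕ} (c c' : KaryVertex k m → C)
    (e : Equiv.Perm (KaryVertex k m)) (he : IsSymmetry e) (h : ∀ x, c' (e x) = c x) :
    code c = code c' := by
  induction m with
  | zero =>
    have := h root
    rw [he.apply_root] at this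
    exact this.symm
  | succ m ih =>
    refine Prod.ext ?_ ?_
    · have := h root
      rw [he.apply_root] at this
      exact this.symm
    · obtain ⟨σ, f, hf, hef⟩ := he.decompose
      have key : ∀ i, code (fun x => c (child i x)) = code (fun x => c' (child (σ i) x)) :=
        fun i => ih _ _ (f i) (hf i) fun x => by rw [← hef, h]
      rw [code_snd, code_snd]
      rw [Multiset.map_congr rfl fun i _ => key i]
      conv_rhs => rw [← Multiset.map_univ_val_equiv σ, Multiset.map_map]
      rfl

/-- A coloring is distinguishing for the rooted tree if only the identity automorphism
preserves it. -/
def Distinguishing {m : ℕ} (c : KaryVertex k m → C) : Prop :=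
  ∀ e : Equiv.Perm (KaryVertex k m), IsSymmetry e → (∀ x, c (e x) = c x) → ∀ x, e x = x

theorem good_code_of_distinguishing {m : ℕ} (c : KaryVertex k m → C) (h : Distinguishing c) :
    (code c).Good k m := by
  classical
  induction m with
  | zero => trivial
  | succ m ih =>
    refine ⟨?_, by simp [code], ?_⟩
    · rw [code_snd]
      refine (Multiset.nodup_map_iff_inj_on Finset.univ.nodup).2 fun i _ j _ hij => ?_
      by_contra hne
      -- an isomorphism between two equally coded subtrees allows one to exchange them
      obtain ⟨e, he, hc⟩ := exists_symmetry_of_code_eq _ _ hij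
      obtain ⟨f, hf, hr, hfc⟩ := exists_symmetry (Equiv.swap i j)
        (fun l => if l = i then e else if l = j then e.symm else Equiv.refl _) (by
          intro l
          split_ifs
          · exact he
          · exact he.symm
          · exact fun _ _ => Iff.rfl)
      have := h f hf (fun x => by
        cases x with
        | root => rw [hr]
        | child l x =>
          rw [hfc]
          by_cases hl : l = i
          · subst hl; simpa using hc x
          · by_cases hl' : l = j
            · subst hl'
              have := hc (e.symm x)
              simp only [Equiv.apply_symm_apply] at this
              simp [hl, this]
            · simp [hl, hl', Equiv.swap_apply_of_ne_of_ne]) (child i root)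
      rw [hfc] at this
      simp only [Equiv.swap_apply_left, child.injEq] at this
      exact hne this.1.symm
    · intro y hy
      rw [code_snd] at hy
      obtain ⟨i, -, rfl⟩ := Multiset.mem_map.1 hy
      -- an automorphism of one subtree extends by the identity
      refine ih _ fun e he hc => ?_
      obtain ⟨f, hf, hr, hfc⟩ := exists_symmetry (Equiv.refl _)
        (fun l => if l = i then e else Equiv.refl _) (by
          intro l
          split_ifs
          · exact he
          · exact fun _ _ => Iff.rfl)
      have := h f hf (fun x => by
        cases x with
        | root => rw [hr]
        | child l x =>
          rw [hfc]
          by_cases hl : l = i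
          · subst hl; simpa using hc x
          · simp [hl])
      intro x
      have := this (child i x)
      rw [hfc] at this
      simpa using this

/-- A color-preserving automorphism cannot permute subtrees with distinct codes, so it acts on each
of them separately. -/
theorem distinguishing_of_good_code {m : ℕ} (c : KaryVertex k m → C)
    (h : (code c).Good k m) : Distinguishing c := by
  induction m with
  | zero => intro e _ _ x; exact Subsingleton.elim _ _
  | succ m ih =>
    intro e he hc
    obtain ⟨h1, -, h2⟩ := h
    rw [code_snd] at h1 h2
    obtain ⟨σ, f, hf, hef⟩ := he.decompose
    have hσ : ∀ i, σ i = i := fun i =>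
      ((Multiset.nodup_map_iff_inj_on Finset.univ.nodup).1 h1 i (Finset.mem_univ i) (σ i)
        (Finset.mem_univ (σ i)) (code_eq_of_symmetry _ _ (f i) (hf i) fun x => by
          rw [← hef, hc])).symm
    intro x
    cases x with
    | root => exact he.apply_root
    | child i x =>
      rw [hef, hσ, ih (fun x => c (child i x)) (h2 _ (Multiset.mem_map_of_mem _
        (Finset.mem_univ i))) (f i) (hf i) fun x => ?_]
      have := hc (child i x)
      rwa [hef, hσ] at this

theorem exists_code_eq {m : ℕ} (x : TreeCode C m) (hx : x.Good k m) :
    ∃ c : KaryVertex k m → C, code c = x := by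
  induction m with
  | zero => exact ⟨fun _ => x, rfl⟩
  | succ m ih =>
    obtain ⟨a, s⟩ := x
    obtain ⟨-, h2, h3⟩ := hx
    induction s using Quotient.inductionOn with
    | _ l =>
    change l.length = k at h2
    subst h2
    choose c hc using fun i : Fin l.length => ih (l.get i) (h3 _ (List.get_mem l i))
    refine ⟨fun x => match x with
      | root => a
      | child i x => c i x, Prod.ext rfl ?_⟩
    rw [code_snd]
    change Multiset.map (fun i => code (c i)) _ = _
    simp only [hc]
    change Multiset.map l.get ((List.finRange l.length : List _) : Multiset _) = (l : Multiset _)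
    rw [Multiset.map_coe, List.map_get_finRange]

theorem cost_code [DecidableEq C] (i₀ : C) {m : ℕ} (c : KaryVertex k m → C) :
    (code c).cost i₀ m = (Finset.univ.filter fun x => c x ≠ i₀).card := by
  induction m with
  | zero =>
    rw [Finset.card_filter, Fintype.sum_unique]
    change (if c root = i₀ then 0 else 1) = (if c root ≠ i₀ then 1 else 0)
    split_ifs <;> simp_all
  | succ m ih =>
    rw [Finset.card_filter, ← (succEquiv k m).symm.sum_comp, Fintype.sum_option,
      Fintype.sum_prod_type]
    change (if c root = i₀ then 0 else 1) + ((code c).2.map _).sum = _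
    rw [code_snd]
    congr 1
    · change _ = (if c root ≠ i₀ then 1 else 0)
      split_ifs <;> simp_all
    · rw [Multiset.map_map]
      refine Finset.sum_congr rfl fun i _ => ?_
      rw [Function.comp_apply, ih, Finset.card_filter]
      rfl

end KaryVertex

/-! ### Minimal costs of good codes -/

namespace TreeCode

variable {C : Type} {i₀ : C} {k m μ : ℕ}

/-- The code with root color `a` whose principal subtrees have the pairwise distinct codes in
`s`. -/
def node (a : C) (s : Finset (TreeCode C m)) : TreeCode C (m + 1) := (a, s.val)

variable (C) in
/-- A tree of depth zero is determined by the color of its only vertex. -/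
def leaf : C ≃ TreeCode C 0 := Equiv.refl _

theorem node_injective {a b : C} {s t : Finset (TreeCode C m)} (h : node a s = node b t) :
    a = b ∧ s = t :=
  ⟨(Prod.ext_iff.1 h).1, Finset.val_injective (Prod.ext_iff.1 h).2⟩

theorem good_node (a : C) (s : Finset (TreeCode C m)) :
    (node a s).Good k (m + 1) ↔ s.card = k ∧ ∀ y ∈ s, y.Good k m :=
  ⟨fun h => h.2, fun h => ⟨s.nodup, h⟩⟩

theorem Good.exists_node {x : TreeCode C (m + 1)} (hx : x.Good k (m + 1)) :
    ∃ (a : C) (s : Finset (TreeCode C m)),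
      x = node a s ∧ s.card = k ∧ ∀ y ∈ s, y.Good k m :=
  ⟨x.1, ⟨x.2, hx.1⟩, rfl, hx.2⟩

variable [DecidableEq C]

theorem cost_node (a : C) (s : Finset (TreeCode C m)) :
    (node a s).cost i₀ (m + 1) = (if a = i₀ then 0 else 1) + ∑ y ∈ s, y.cost i₀ m := rfl

theorem cost_leaf (a : C) : (leaf C a).cost i₀ 0 = if a = i₀ then 0 else 1 := rfl

theorem mul_le_cost (hμ : ∀ x : TreeCode C m, x.Good k m → μ ≤ x.cost i₀ m)
    (x : TreeCode C (m + 1)) (hx : x.Good k (m + 1)) : k * μ ≤ x.cost i₀ (m + 1) := by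
  obtain ⟨a, s, rfl, hs, h⟩ := hx.exists_node
  rw [cost_node]
  have h1 : s.card • μ ≤ ∑ y ∈ s, y.cost i₀ m :=
    Finset.card_nsmul_le_sum s _ μ fun y hy => hμ y (h y hy)
  rw [hs, smul_eq_mul] at h1
  omega

/-- If there is only one good code of the least cost `μ`, then at most one of the `k` pairwise
distinct principal subtrees has cost `μ`. -/
theorem mul_add_le_cost (hk : 1 ≤ k) (hμ : ∀ x : TreeCode C m, x.Good k m → μ ≤ x.cost i₀ m)
    (huniq : ∀ x y : TreeCode C m, x.Good k m → y.Good k m → x.cost i₀ m = μ →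
      y.cost i₀ m = μ → x = y)
    (x : TreeCode C (m + 1)) (hx : x.Good k (m + 1)) :
    k * μ + (k - 1) ≤ x.cost i₀ (m + 1) := by
  classical
  obtain ⟨a, s, rfl, hs, h⟩ := hx.exists_node
  rw [cost_node]
  -- count each subtree of cost `μ` with an extra unit, which brings all of them to `μ + 1`
  have h1 : s.card • (μ + 1) ≤ ∑ y ∈ s, (cost i₀ m y + if cost i₀ m y = μ then 1 else 0) := by
    refine Finset.card_nsmul_le_sum s _ _ fun y hy => ?_
    have := hμ y (h y hy)
    split_ifs <;> omega
  have h2 : (s.filter fun y => cost i₀ m y = μ).card ≤ 1 := by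
    refine Finset.card_le_one.2 fun y hy z hz => ?_
    rw [Finset.mem_filter] at hy hz
    exact huniq y z (h y hy.1) (h z hz.1) hy.2 hz.2
  rw [Finset.sum_add_distrib, ← Finset.card_filter, hs, smul_eq_mul, mul_add, mul_one] at h1
  omega

/-- Any `k` good codes of cost `μ` can be grafted below a root of the color `i₀`. -/
theorem graft (s : Finset (TreeCode C m)) (hs : s.card = k)
    (h : ∀ y ∈ s, y.Good k m ∧ y.cost i₀ m = μ) :
    (node i₀ s).Good k (m + 1) ∧ (node i₀ s).cost i₀ (m + 1) = k * μ := by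
  refine ⟨(good_node _ _).2 ⟨hs, fun y hy => (h y hy).1⟩, ?_⟩
  rw [cost_node, Finset.sum_congr rfl fun y hy => (h y hy).2]
  simp [hs]

variable (i₀) (k) in
/-- There are at least `N` good codes of cost `μ` and depth `m`. -/
def Many (m μ N : ℕ) : Prop :=
  ∃ S : Finset (TreeCode C m), N ≤ S.card ∧ ∀ x ∈ S, x.Good k m ∧ x.cost i₀ m = μ

/-- With more than `k` good codes of least cost there are again more than `k` of them one level
higher, since `k` of them have to be chosen as principal subtrees. -/
theorem Many.succ (h : Many i₀ k m μ (k + 1)) : Many i₀ k (m + 1) (k * μ) (k + 1) := by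
  classical
  obtain ⟨S, hS, hx⟩ := h
  refine ⟨(S.powersetCard k).image (node i₀), ?_, ?_⟩
  · rw [Finset.card_image_of_injective _ fun _ _ h => (node_injective h).2,
      Finset.card_powersetCard]
    calc k + 1 = (k + 1).choose k := (Nat.choose_succ_self_right k).symm
      _ ≤ _ := Nat.choose_le_choose _ hS
  · intro x hxm
    obtain ⟨s, hs, rfl⟩ := Finset.mem_image.1 hxm
    rw [Finset.mem_powersetCard] at hs
    exact graft s hs.2 fun y hy => hx y (hs.1 hy)

theorem Many.exists_good {N : ℕ} (h : Many i₀ k m μ (N + 1)) :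
    ∃ x : TreeCode C m, x.Good k m ∧ x.cost i₀ m = μ := by
  obtain ⟨S, hS, hx⟩ := h
  obtain ⟨x, hxS⟩ := Finset.card_pos.1 (by omega : 0 < S.card)
  exact ⟨x, hx x hxS⟩

theorem sum_cost_leaves (s : Finset C) :
    ∑ y ∈ s.map (leaf C).toEmbedding, y.cost i₀ 0 = (s.erase i₀).card := by
  rw [Finset.sum_map, ← Finset.filter_ne', Finset.card_filter]
  refine Finset.sum_congr rfl fun y _ => ?_
  change (leaf C y).cost i₀ 0 = _
  rw [cost_leaf, ite_not]

/-- Two leaves of a star never share a color, so at most one of them has the color `i₀`. -/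
theorem le_cost_one (hk : 1 ≤ k) (x : TreeCode C 1) (hx : x.Good k 1) :
    k - 1 ≤ x.cost i₀ 1 := by
  have h := mul_add_le_cost (i₀ := i₀) (m := 0) (μ := 0) hk (fun _ _ => Nat.zero_le _)
    (fun x y _ _ h1 h2 => by
      obtain ⟨x, rfl⟩ := (leaf C).surjective x
      obtain ⟨y, rfl⟩ := (leaf C).surjective y
      rw [cost_leaf] at h1 h2
      split_ifs at h1 h2 with h3 h4
      rw [h3, h4]) x hx
  rwa [mul_zero, zero_add] at h

theorem le_cost_two (hk : 1 ≤ k) (x : TreeCode C 2) (hx : x.Good k 2) :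
    k * (k - 1) ≤ x.cost i₀ 2 :=
  mul_le_cost (le_cost_one hk) x hx

section

variable [Fintype C]

/-- A star with center of color `a` whose leaves have all colors but `b`. -/
def star (a b : C) : TreeCode C 1 := node a ((Finset.univ.erase b).map (leaf C).toEmbedding)

theorem star_injective (a : C) : Function.Injective (star a) := by
  intro b b' h
  have h1 := Finset.map_injective _ (node_injective h).2
  by_contra hne
  have h2 : b ∈ Finset.univ.erase b' := Finset.mem_erase.2 ⟨hne, Finset.mem_univ _⟩
  rw [← h1] at h2
  exact Finset.notMem_erase _ _ h2

theorem star_good (hC : Fintype.card C = k + 1) (a b : C) : (star a b).Good k 1 := by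
  refine (good_node _ _).2 ⟨?_, fun _ _ => trivial⟩
  rw [Finset.card_map, Finset.card_erase_of_mem (Finset.mem_univ b), Finset.card_univ, hC]
  omega

theorem star_cost (a b : C) :
    (star a b).cost i₀ 1 =
      (if a = i₀ then 0 else 1) + ((Finset.univ.erase b).erase i₀).card := by
  rw [star, cost_node, sum_cost_leaves]

theorem star_cost_of_ne (hC : Fintype.card C = k + 1) {b : C} (hb : b ≠ i₀) :
    (star i₀ b).cost i₀ 1 = k - 1 := by
  rw [star_cost, Finset.card_erase_of_mem (by simpa using hb.symm),
    Finset.card_erase_of_mem (Finset.mem_univ b), Finset.card_univ, hC]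
  simp

variable (i₀) in
/-- The stars of least cost: the center has the color `i₀`, which also occurs on a leaf. There is
one for each choice of a missing leaf color other than `i₀`. -/
def minStars : Finset (TreeCode C 1) :=
  (Finset.univ.erase i₀).map ⟨star i₀, star_injective i₀⟩

theorem card_minStars (hC : Fintype.card C = k + 1) : (minStars i₀).card = k := by
  rw [minStars, Finset.card_map, Finset.card_erase_of_mem (Finset.mem_univ _),
    Finset.card_univ, hC]
  omega

theorem mem_minStars {x : TreeCode C 1} : x ∈ minStars i₀ ↔ ∃ b, b ≠ i₀ ∧ star i₀ b = x := by
  simp [minStars]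

theorem minStars_spec (hC : Fintype.card C = k + 1) (x : TreeCode C 1) (hx : x ∈ minStars i₀) :
    x.Good k 1 ∧ x.cost i₀ 1 = k - 1 := by
  obtain ⟨b, hb, rfl⟩ := mem_minStars.1 hx
  exact ⟨star_good hC _ _, star_cost_of_ne hC hb⟩

/-- If the cost of a star is only `k - 1`, then `i₀` occurs on the center and on a leaf; the `k`
leaves miss exactly one of the `k + 1` colors. -/
theorem mem_minStars_of_cost (hk : 2 ≤ k) (hC : Fintype.card C = k + 1) (x : TreeCode C 1)
    (hx : x.Good k 1) (hc : x.cost i₀ 1 = k - 1) : x ∈ minStars i₀ := by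
  obtain ⟨a, s', rfl, hs, -⟩ := hx.exists_node
  obtain ⟨s, rfl⟩ : ∃ s : Finset C, s' = s.map (leaf C).toEmbedding :=
    ⟨s'.map (leaf C).symm.toEmbedding, by ext; simp⟩
  rw [Finset.card_map] at hs
  have hc' : (if a = i₀ then 0 else 1) + (s.erase i₀).card = k - 1 := by
    rw [← hc, cost_node, sum_cost_leaves]
  have hi : i₀ ∈ s := by
    by_contra hi
    rw [Finset.erase_eq_of_notMem hi, hs] at hc'
    omega
  rw [Finset.card_erase_of_mem hi, hs] at hc'
  have ha : a = i₀ := by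
    by_contra ha
    rw [if_neg ha] at hc'
    omega
  subst ha
  have hcompl : sᶜ.card = 1 := by rw [Finset.card_compl, hC, hs]; omega
  obtain ⟨b, hb⟩ := Finset.card_eq_one.1 hcompl
  have hsb : s = Finset.univ.erase b := by
    rw [← compl_compl s, hb]
    ext y; simp
  refine mem_minStars.2 ⟨b, ?_, by rw [star, hsb]⟩
  rintro rfl
  rw [hsb] at hi
  exact Finset.notMem_erase _ _ hi

variable (i₀) in
/-- The code of depth two with a root of color `a` and with all stars of least cost. -/
def allStars (a : C) : TreeCode C 2 := node a (minStars i₀)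

theorem allStars_spec (hC : Fintype.card C = k + 1) :
    (allStars i₀ i₀).Good k 2 ∧ (allStars i₀ i₀).cost i₀ 2 = k * (k - 1) :=
  graft _ (card_minStars hC) (minStars_spec hC)

theorem allStars_spec_of_ne (hC : Fintype.card C = k + 1) {a : C} (ha : a ≠ i₀) :
    (allStars i₀ a).Good k 2 ∧ (allStars i₀ a).cost i₀ 2 = k * (k - 1) + 1 := by
  obtain ⟨h1, h2⟩ := allStars_spec (i₀ := i₀) hC
  refine ⟨h1, ?_⟩
  rw [allStars, cost_node, if_pos rfl] at h2
  rw [allStars, cost_node, if_neg ha]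
  omega

/-- Only `k` stars have the least cost, so a code of depth two of least cost has to use all of
them. -/
theorem eq_allStars (hk : 2 ≤ k) (hC : Fintype.card C = k + 1) (x : TreeCode C 2)
    (hx : x.Good k 2) (hc : x.cost i₀ 2 = k * (k - 1)) : x = allStars i₀ i₀ := by
  obtain ⟨a, s, rfl, hs, h⟩ := hx.exists_node
  rw [cost_node] at hc
  have hle : ∀ y ∈ s, k - 1 ≤ cost i₀ 1 y := fun y hy => le_cost_one (by omega) y (h y hy)
  -- the subtrees alone use up the whole cost, so the root is free and each star is minimal
  have hsum : ∑ y ∈ s, (k - 1) = k * (k - 1) := by simp [hs]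
  have hge := Finset.sum_le_sum hle
  have ha : a = i₀ := by
    by_contra ha
    rw [if_neg ha] at hc
    omega
  have heq : ∑ y ∈ s, (k - 1) = ∑ y ∈ s, cost i₀ 1 y := by
    rw [if_pos ha] at hc; omega
  have hall := (Finset.sum_eq_sum_iff_of_le hle).1 heq
  have hsub : s ⊆ minStars i₀ := fun y hy =>
    mem_minStars_of_cost hk hC y (h y hy) (hall y hy).symm
  rw [Finset.eq_of_subset_of_card_le hsub (by rw [hs, card_minStars hC]), ha]
  rfl

/-- There are more than `k` codes of depth two whose cost exceeds the least one by one: the root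
may be recolored, or one star may be replaced by the star without `i₀` on its leaves. -/
theorem many_two (hk : 2 ≤ k) (hC : Fintype.card C = k + 1) :
    Many i₀ k 2 (k * (k - 1) + 1) (k + 1) := by
  classical
  have hne : (minStars i₀).Nonempty := by
    rw [← Finset.card_pos, card_minStars hC]; omega
  obtain ⟨x₁, hx₁⟩ := hne
  have hz : star i₀ i₀ ∉ minStars i₀ := by
    intro h
    obtain ⟨b, hb, h⟩ := mem_minStars.1 h
    exact hb (star_injective i₀ h)
  have hzc : (star i₀ i₀).cost i₀ 1 = k := by
    rw [star_cost, Finset.erase_idem, Finset.card_erase_of_mem (Finset.mem_univ _),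
      Finset.card_univ, hC]
    simp
  have hz' : star i₀ i₀ ∉ (minStars i₀).erase x₁ := fun h => hz (Finset.mem_of_mem_erase h)
  have hcard : ((minStars i₀).erase x₁).card = k - 1 := by
    rw [Finset.card_erase_of_mem hx₁, card_minStars hC]
  let w : TreeCode C 2 := node i₀ (insert (star i₀ i₀) ((minStars i₀).erase x₁))
  have hw : w.Good k 2 ∧ w.cost i₀ 2 = k * (k - 1) + 1 := by
    constructor
    · refine (good_node _ _).2 ⟨?_, ?_⟩
      · rw [Finset.card_insert_of_notMem hz', hcard]; omega
      · intro y hy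
        rcases Finset.mem_insert.1 hy with rfl | hy
        · exact star_good hC _ _
        · exact (minStars_spec hC y (Finset.mem_of_mem_erase hy)).1
    · rw [cost_node, Finset.sum_insert hz', hzc, Finset.sum_congr rfl fun y hy =>
        (minStars_spec hC y (Finset.mem_of_mem_erase hy)).2, Finset.sum_const, hcard, if_pos rfl,
        smul_eq_mul]
      obtain ⟨j, rfl⟩ := Nat.exists_eq_add_of_le hk
      have : 2 + j - 1 = j + 1 := by omega
      rw [this]
      ring
  refine ⟨insert w ((Finset.univ.erase i₀).image (allStars i₀)), ?_, ?_⟩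
  · rw [Finset.card_insert_of_notMem, Finset.card_image_of_injective,
      Finset.card_erase_of_mem (Finset.mem_univ _), Finset.card_univ, hC]
    · omega
    · exact fun a b h => (node_injective h).1
    · intro h
      obtain ⟨a, ha, h⟩ := Finset.mem_image.1 h
      exact (Finset.mem_erase.1 ha).1 (node_injective h).1
  · intro x hx
    rcases Finset.mem_insert.1 hx with rfl | hx
    · exact hw
    · obtain ⟨a, ha, rfl⟩ := Finset.mem_image.1 hx
      exact allStars_spec_of_ne hC (Finset.mem_erase.1 ha).1

/-- A code of depth three of least cost consists of the code of depth two of least cost and of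
`k - 1` codes whose cost is one more. -/
theorem many_three (hk : 2 ≤ k) (hC : Fintype.card C = k + 1) :
    Many i₀ k 3 ((k - 1) * (k ^ 2 + 1)) (k + 1) := by
  classical
  obtain ⟨S, hS, hx⟩ := many_two (i₀ := i₀) hk hC
  obtain ⟨hb, hbc⟩ := allStars_spec (i₀ := i₀) hC
  have hbS : allStars i₀ i₀ ∉ S := by
    intro h
    have := (hx _ h).2
    omega
  refine ⟨(S.powersetCard (k - 1)).image fun s => node i₀ (insert (allStars i₀ i₀) s), ?_, ?_⟩
  · rw [Finset.card_image_of_injOn, Finset.card_powersetCard]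
    · -- `(k + 1).choose (k - 1) = (k + 1) * k / 2`, which is at least `k + 1` as `2 ≤ k`
      calc k + 1 ≤ (k + 1).choose (k - 1) := by
            obtain ⟨j, rfl⟩ := Nat.exists_eq_add_of_le hk
            have h2 : 2 + j + 1 = (2 + j - 1) + 2 := by omega
            rw [Nat.choose_symm_of_eq_add h2, Nat.choose_two_right,
              Nat.le_div_iff_mul_le (by norm_num)]
            have : 2 + j + 1 - 1 = j + 2 := by omega
            rw [this]
            nlinarith
        _ ≤ _ := Nat.choose_le_choose _ hS
    · intro s hs t ht hst
      have hs' := Finset.mem_powersetCard.1 hs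
      have ht' := Finset.mem_powersetCard.1 ht
      have := (node_injective hst).2
      rw [← Finset.erase_insert fun h => hbS (hs'.1 h), this,
        Finset.erase_insert fun h => hbS (ht'.1 h)]
  · intro x hxm
    obtain ⟨s, hs, rfl⟩ := Finset.mem_image.1 hxm
    rw [Finset.mem_powersetCard] at hs
    have hbs : allStars i₀ i₀ ∉ s := fun h => hbS (hs.1 h)
    constructor
    · refine (good_node _ _).2 ⟨?_, ?_⟩
      · rw [Finset.card_insert_of_notMem hbs, hs.2]; omega
      · intro y hy
        rcases Finset.mem_insert.1 hy with rfl | hy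
        · exact hb
        · exact (hx y (hs.1 hy)).1
    · rw [cost_node, Finset.sum_insert hbs, hbc, Finset.sum_congr rfl fun y hy =>
        (hx y (hs.1 hy)).2, Finset.sum_const, hs.2, if_pos rfl, smul_eq_mul]
      obtain ⟨j, rfl⟩ := Nat.exists_eq_add_of_le hk
      have : 2 + j - 1 = j + 1 := by omega
      rw [this]
      ring

/-- By uniqueness of the code of depth two of least cost, it occurs at most once among the principal
subtrees. -/
theorem le_cost_three (hk : 2 ≤ k) (hC : Fintype.card C = k + 1) (x : TreeCode C 3)
    (hx : x.Good k 3) : (k - 1) * (k ^ 2 + 1) ≤ x.cost i₀ 3 := by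
  have := mul_add_le_cost (i₀ := i₀) (by omega) (le_cost_two (by omega)) (fun x y hx hy h1 h2 =>
    (eq_allStars hk hC x hx h1).trans (eq_allStars hk hC y hy h2).symm) x hx
  calc _ = k * (k * (k - 1)) + (k - 1) := by ring
    _ ≤ _ := this

theorem many_add_three (hk : 2 ≤ k) (hC : Fintype.card C = k + 1) (j : ℕ) :
    Many i₀ k (j + 3) ((k - 1) * (k ^ 2 + 1) * k ^ j) (k + 1) := by
  induction j with
  | zero => simpa using many_three hk hC
  | succ j ih =>
    have := ih.succ
    rwa [show k * ((k - 1) * (k ^ 2 + 1) * k ^ j) = (k - 1) * (k ^ 2 + 1) * k ^ (j + 1) by ring]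
      at this

theorem le_cost_add_three (hk : 2 ≤ k) (hC : Fintype.card C = k + 1) (j : ℕ)
    (x : TreeCode C (j + 3)) (hx : x.Good k (j + 3)) :
    (k - 1) * (k ^ 2 + 1) * k ^ j ≤ x.cost i₀ (j + 3) := by
  induction j with
  | zero => simpa using le_cost_three hk hC x hx
  | succ j ih =>
    have := mul_le_cost ih x hx
    rwa [show k * ((k - 1) * (k ^ 2 + 1) * k ^ j) = (k - 1) * (k ^ 2 + 1) * k ^ (j + 1) by ring]
      at this

end

end TreeCode

/-! ### Perfect trees and the model tree -/

namespace SimpleGraph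

variable {V : Type*} {G : SimpleGraph V} {r : V}

variable (G r) in
/-- With respect to the root `r`, the vertex `w` is a child of its neighbor `u`. -/
def IsChild (u w : V) : Prop := G.Adj u w ∧ G.dist r w = G.dist r u + 1

theorem IsTree.adj_iff_isChild (hG : G.IsTree) (u w : V) :
    G.Adj u w ↔ G.IsChild r u w ∨ G.IsChild r w u := by
  constructor
  · intro h
    rcases hG.dist_eq_dist_add_one_of_adj r h with h1 | h1
    · exact .inr ⟨h.symm, h1⟩
    · exact .inl ⟨h, h1⟩
  · rintro (h | h)
    · exact h.1
    · exact h.1.symm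

/-- A vertex has at most one parent: geodesics from the root through two parents would be distinct
paths with the same ends. -/
theorem IsTree.isChild_unique (hG : G.IsTree) {u u' w : V} (h : G.IsChild r u w)
    (h' : G.IsChild r u' w) : u = u' := by
  have key : ∀ v, G.IsChild r v w → ∃ p : G.Walk r w, p.IsPath ∧ p.penultimate = v := by
    intro v hv
    obtain ⟨p, hp⟩ := hG.connected.exists_walk_length_eq_dist r v
    refine ⟨p.concat hv.1, Walk.isPath_of_length_eq_dist _ ?_, by simp⟩
    rw [Walk.length_concat, hp, hv.2]
  obtain ⟨p, hp, rfl⟩ := key u h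
  obtain ⟨q, hq, rfl⟩ := key u' h'
  have hpq := (hG.isAcyclic.subsingleton_path r w).elim ⟨p, hp⟩ ⟨q, hq⟩
  rw [show p = q from congrArg Subtype.val hpq]

theorem IsTree.exists_isChild (hG : G.IsTree) {w : V} (h : w ≠ r) : ∃ u, G.IsChild r u w := by
  obtain ⟨p, hp⟩ := hG.connected.exists_walk_length_eq_dist r w
  have hnil : ¬ p.Nil := fun hn => h hn.eq.symm
  have hadj := p.adj_penultimate hnil
  refine ⟨p.penultimate, hadj, ?_⟩
  have h1 := dist_le p.dropLast
  have h2 : p.dropLast.length + 1 = p.length := by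
    simp
    have := Walk.not_nil_iff_lt_length.1 hnil
    omega
  rcases hG.dist_eq_dist_add_one_of_adj r hadj with h3 | h3 <;> omega

/-- The vertex reached from `v` along an address, where `ch u i` is the `i`-th child of `u`. -/
def descend {k : ℕ} (ch : V → Fin k → V) : ∀ {m : ℕ}, V → KaryVertex k m → V
  | _, v, .root => v
  | _, v, .child i x => descend ch (ch v i) x

section

open KaryVertex

variable {k n : ℕ} {ch : V → Fin k → V}

theorem isChild_descend (hch : ∀ u, G.dist r u < n → ∀ i, G.IsChild r u (ch u i)) {m : ℕ}
    {x y : KaryVertex k m} (h : Parent x y) (v : V) (hv : G.dist r v + m = n) :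
    G.IsChild r (descend ch v x) (descend ch v y) := by
  induction h generalizing v with
  | top i => exact hch v (by omega) i
  | step i h ih =>
    refine ih (ch v i) ?_
    rw [(hch v (by omega) i).2]
    omega

theorem dist_lt_descend (hch : ∀ u, G.dist r u < n → ∀ i, G.IsChild r u (ch u i)) {m : ℕ}
    (x : KaryVertex k m) (hx : x ≠ root) (v : V) (hv : G.dist r v + m = n) :
    G.dist r v < G.dist r (descend ch v x) := by
  induction x generalizing v with
  | root => exact absurd rfl hx
  | child i x ih =>
    have h1 := (hch v (by omega) i).2
    by_cases hx' : x = root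
    · subst hx'
      change _ < G.dist r (ch v i)
      omega
    · have := ih hx' (ch v i) (by omega)
      change _ < G.dist r (descend ch (ch v i) x)
      omega

theorem siblings_eq (hch : ∀ u, G.dist r u < n → ∀ i, G.IsChild r u (ch u i))
    (hinj : ∀ u, G.dist r u < n → Function.Injective (ch u)) {m : ℕ}
    {x y z : KaryVertex k m} (hy : Parent x y) (hz : Parent x z) (v : V)
    (hv : G.dist r v + m = n) (h : descend ch v y = descend ch v z) : y = z := by
  induction hy generalizing v with
  | top i =>
    cases hz with
    | top j => rw [hinj v (by omega) h]
  | step i hy ih =>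
    cases hz with
    | step _ hz =>
      rw [ih hz (ch v i) (by have := (hch v (by omega) i).2; omega) h]

theorem descend_injective (hG : G.IsTree)
    (hch : ∀ u, G.dist r u < n → ∀ i, G.IsChild r u (ch u i))
    (hinj : ∀ u, G.dist r u < n → Function.Injective (ch u)) {m : ℕ} (v : V)
    (hv : G.dist r v + m = n) :
    Function.Injective (descend ch v : KaryVertex k m → V) := by
  intro x
  induction x using parent_induction with
  | h0 =>
    intro y hy
    by_contra hne
    have := dist_lt_descend hch y (Ne.symm hne) v hv
    rw [← hy] at this
    exact lt_irrefl _ this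
  | h1 x' x hx ih =>
    intro y hy
    have hyr : y ≠ root := by
      rintro rfl
      have := dist_lt_descend hch x (by rintro rfl; exact not_parent_root _ hx) v hv
      rw [hy] at this
      exact lt_irrefl _ this
    obtain ⟨y', hy'⟩ := exists_parent y hyr
    have h1 := isChild_descend hch hx v hv
    have h2 := isChild_descend hch hy' v hv
    rw [hy] at h1
    obtain rfl := ih (hG.isChild_unique h1 h2)
    exact siblings_eq hch hinj hx hy' v hv hy

theorem exists_descend_eq_child (hch : ∀ u, G.dist r u < n → ∀ i, G.IsChild r u (ch u i))
    {m : ℕ} (x : KaryVertex k m) (v : V) (hv : G.dist r v + m = n)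
    (hx : G.dist r (descend ch v x) < n) (i : Fin k) :
    ∃ y : KaryVertex k m, descend ch v y = ch (descend ch v x) i := by
  induction x generalizing v with
  | @root m =>
    change G.dist r v < n at hx
    obtain ⟨m, rfl⟩ := Nat.exists_eq_succ_of_ne_zero (by omega : m ≠ 0)
    exact ⟨child i root, rfl⟩
  | child j x ih =>
    obtain ⟨y, hy⟩ := ih (ch v j) (by have := (hch v (by omega) j).2; omega) hx
    exact ⟨child j y, hy⟩

/-- A tree in which every vertex at distance less than `n` from `r` has the `k` children
`ch u i`, and no other vertex has children, is isomorphic to the model tree. -/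
theorem exists_equiv_of_children (hG : G.IsTree)
    (hch : ∀ u, G.dist r u < n → ∀ i, G.IsChild r u (ch u i))
    (hinj : ∀ u, G.dist r u < n → Function.Injective (ch u))
    (hsurj : ∀ u w, G.IsChild r u w → G.dist r u < n ∧ ∃ i, ch u i = w) :
    ∃ e : KaryVertex k n ≃ V, ∀ x y, G.IsChild r (e x) (e y) ↔ Parent x y := by
  have h0 : G.dist r r + n = n := by simp
  have hs : ∀ (d : ℕ) (w : V), G.dist r w = d → ∃ x : KaryVertex k n, descend ch r x = w := by
    intro d
    induction d with
    | zero =>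
      intro w hw
      exact ⟨root, hG.connected.dist_eq_zero_iff.1 hw⟩
    | succ d ih =>
      intro w hw
      obtain ⟨u, hu⟩ := hG.exists_isChild (r := r) (w := w) (by rintro rfl; simp at hw)
      obtain ⟨x, rfl⟩ := ih u (by have := hu.2; omega)
      obtain ⟨hlt, i, rfl⟩ := hsurj _ _ hu
      exact exists_descend_eq_child hch x r h0 hlt i
  refine ⟨Equiv.ofBijective (descend ch r)
    ⟨descend_injective hG hch hinj r h0, fun w => hs _ w rfl⟩, fun x y => ⟨fun h => ?_, fun h =>
      isChild_descend hch h r h0⟩⟩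
  change G.IsChild r (descend ch r x) (descend ch r y) at h
  obtain ⟨z, hz⟩ := exists_parent y (by
    rintro rfl
    have := h.2
    change G.dist r r = _ at this
    simp at this)
  rwa [descend_injective hG hch hinj r h0
    (hG.isChild_unique h (isChild_descend hch hz r h0))]

end

/-- Among the neighbors of a vertex, all but the parent of a non-root vertex are its children. -/
theorem IsTree.degree_eq_children [Fintype V] [DecidableEq V] [DecidableRel G.Adj]
    (hG : G.IsTree) (u : V) :
    G.degree u = Nat.card {w // G.IsChild r u w} + if u = r then 0 else 1 := by
  classical
  have hsplit : G.neighborFinset u =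
      Finset.univ.filter (fun w => G.IsChild r u w) ∪
        Finset.univ.filter (fun w => G.IsChild r w u) := by
    ext w
    simp [hG.adj_iff_isChild (r := r)]
  have hdisj : Disjoint (Finset.univ.filter fun w => G.IsChild r u w)
      (Finset.univ.filter fun w => G.IsChild r w u) := by
    refine Finset.disjoint_filter.2 fun w _ h1 h2 => ?_
    have := h1.2
    have := h2.2
    omega
  rw [← card_neighborFinset_eq_degree, hsplit, Finset.card_union_of_disjoint hdisj,
    Nat.card_eq_fintype_card, Fintype.card_subtype]
  congr 1
  split_ifs with hu
  · subst hu
    refine Finset.card_eq_zero.2 (Finset.filter_eq_empty_iff.2 fun w _ h => ?_)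
    have := h.2
    simp at this
  · obtain ⟨v, hv⟩ := hG.exists_isChild hu
    refine Finset.card_eq_one.2 ⟨v, ?_⟩
    ext w
    simp only [Finset.mem_filter, Finset.mem_univ, true_and, Finset.mem_singleton]
    exact ⟨fun hw => hG.isChild_unique hw hv, fun hw => hw ▸ hv⟩

/-- A perfect `k`-ary tree of depth `n` is isomorphic to the model tree, and its root is fixed by
all automorphisms, being the only vertex of degree `k`. -/
theorem IsPerfectKaryTree.exists_equiv [Fintype V] [DecidableRel G.Adj] {k n : ℕ} (hk : 2 ≤ k)
    (hG : G.IsPerfectKaryTree k n) :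
    ∃ (r : V) (e : KaryVertex k n ≃ V),
      (∀ φ : G ≃g G, φ r = r) ∧ ∀ x y, G.IsChild r (e x) (e y) ↔ KaryVertex.Parent x y := by
  classical
  obtain ⟨hT, -, r, hr, hleaf, hint⟩ := hG
  have hdeg : ∀ u, G.degree u = Nat.card {w // G.IsChild r u w} + if u = r then 0 else 1 :=
    fun u => hT.degree_eq_children u
  -- a vertex at maximal distance from the root is a leaf
  have hle : ∀ u, G.dist r u ≤ n := by
    obtain ⟨w, -, hw⟩ := Finset.exists_max_image Finset.univ (G.dist r) ⟨r, Finset.mem_univ r⟩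
    have hc : IsEmpty {z // G.IsChild r w z} :=
      ⟨fun z => by have := hw z.1 (Finset.mem_univ _); have := z.2.2; omega⟩
    have h1 := hdeg w
    rw [Nat.card_of_isEmpty] at h1
    have hwr : w ≠ r := by
      rintro rfl
      rw [if_pos rfl, hr] at h1
      omega
    rw [if_neg hwr] at h1
    intro u
    rw [← hleaf w h1]
    exact hw u (Finset.mem_univ _)
  have hcard : ∀ u, G.dist r u < n → Nat.card {w // G.IsChild r u w} = k := by
    intro u hu
    have h1 := hdeg u
    by_cases hur : u = r
    · subst hur
      rw [if_pos rfl, hr] at h1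
      omega
    · rw [if_neg hur, hint u hur fun h => by rw [hleaf u h] at hu; exact lt_irrefl _ hu] at h1
      omega
  have hex : ∀ u, ∃ g : Fin k → V, G.dist r u < n →
      Function.Injective g ∧ Set.range g = {w | G.IsChild r u w} := by
    intro u
    by_cases hu : G.dist r u < n
    · obtain ⟨e⟩ : Nonempty (Fin k ≃ {w // G.IsChild r u w}) :=
        ⟨(Finite.equivFinOfCardEq (hcard u hu)).symm⟩
      refine ⟨fun i => (e i).1, fun _ => ⟨Subtype.val_injective.comp e.injective, ?_⟩⟩
      rw [show (fun i => (e i).1) = Subtype.val ∘ e from rfl, Set.range_comp, e.range_eq_univ,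
        Set.image_univ]
      exact Subtype.range_val
    · exact ⟨fun _ => r, fun h => absurd h hu⟩
  choose ch hch using hex
  obtain ⟨e, he⟩ := exists_equiv_of_children (n := n) hT
    (fun u hu i => by
      have : ch u i ∈ Set.range (ch u) := ⟨i, rfl⟩
      rwa [(hch u hu).2] at this)
    (fun u hu => (hch u hu).1)
    (fun u w huw => by
      have hu : G.dist r u < n := by have := hle w; have := huw.2; omega
      refine ⟨hu, ?_⟩
      have : w ∈ Set.range (ch u) := by rw [(hch u hu).2]; exact huw
      exact this)
  refine ⟨r, e, fun φ => ?_, he⟩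
  -- the other degrees are `1` and `k + 1`, and `k ≠ 1`
  by_contra hne
  have h1 : G.degree (φ r) = k := by rw [φ.degree_eq, hr]
  have h2 := hint _ hne (by omega)
  omega

theorem dist_apply_of_iso (φ : G ≃g G) (u w : V) (hG : G.Connected) :
    G.dist (φ u) (φ w) = G.dist u w := by
  have key : ∀ (ψ : G ≃g G) a b, G.dist (ψ a) (ψ b) ≤ G.dist a b := by
    intro ψ a b
    obtain ⟨p, hp⟩ := hG.exists_walk_length_eq_dist a b
    rw [← hp, ← Walk.length_map ψ.toHom p]
    exact dist_le _
  refine le_antisymm (key φ u w) ?_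
  have := key φ.symm (φ u) (φ w)
  simpa using this

/-- Colorings of `G` are distinguishing exactly if the corresponding colorings of the model tree
are. -/
theorem isDistinguishing_iff {C : Type} {k n : ℕ} (hG : G.IsTree) (hr : ∀ φ : G ≃g G, φ r = r)
    (e : KaryVertex k n ≃ V) (he : ∀ x y, G.IsChild r (e x) (e y) ↔ KaryVertex.Parent x y)
    (c : V → C) :
    G.IsDistinguishing c ↔ KaryVertex.Distinguishing fun x => c (e x) := by
  constructor
  · -- adjacency is determined by the parent relation, so symmetries of the model act on `G`
    intro h f hf hc x
    let p : Equiv.Perm V := (e.symm.trans f).trans e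
    have hp : ∀ x, p (e x) = e (f x) := fun x => by simp [p]
    have hchild : ∀ u w, G.IsChild r (p u) (p w) ↔ G.IsChild r u w := by
      intro u w
      obtain ⟨x, rfl⟩ := e.surjective u
      obtain ⟨y, rfl⟩ := e.surjective w
      rw [hp, hp, he, he, hf]
    let φ : G ≃g G := ⟨p, fun {u w} => by
      rw [hG.adj_iff_isChild (r := r), hG.adj_iff_isChild (r := r), hchild, hchild]⟩
    have h1 := h φ (fun v => by
      obtain ⟨y, rfl⟩ := e.surjective v
      change c (p (e y)) = _
      rw [hp]
      exact hc y) (e x)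
    change p (e x) = e x at h1
    rw [hp] at h1
    exact e.injective h1
  · -- an automorphism of `G` fixes `r`, so it preserves distances from `r` and parents
    intro h φ hc v
    have hdist : ∀ u, G.dist r (φ u) = G.dist r u := fun u => by
      have := dist_apply_of_iso φ r u hG.connected
      rwa [hr] at this
    have h1 := h ((e.trans φ.toEquiv).trans e.symm) (fun x y => by
      rw [← he, ← he]
      simp [IsChild, hdist, φ.map_adj_iff]) (fun x => by simp [hc]) (e.symm v)
    simpa using h1

/-- The paint cost is the least cost of a good code. The witness `hex` makes the infimum a minimum,
so that the convention for graphs without distinguishing colorings plays no role. -/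
theorem IsPerfectKaryTree.paintCost_eq [Fintype V] [DecidableRel G.Adj] {k n : ℕ} (hk : 2 ≤ k)
    (hG : G.IsPerfectKaryTree k n) {d N : ℕ} {i₀ : Fin d}
    (hex : ∃ x : TreeCode (Fin d) n, x.Good k n ∧ x.cost i₀ n = N)
    (hle : ∀ (i : Fin d) (x : TreeCode (Fin d) n), x.Good k n → N ≤ x.cost i n) :
    G.paintCost d = N := by
  classical
  obtain ⟨r, e, hr, he⟩ := hG.exists_equiv hk
  have hcost : ∀ (c : V → Fin d) (i : Fin d), (Finset.univ.filter fun v => c v ≠ i).card =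
      (KaryVertex.code fun x => c (e x)).cost i n := by
    intro c i
    rw [KaryVertex.cost_code, Finset.card_filter, Finset.card_filter, ← e.sum_comp]
  refine IsLeast.csInf_eq ⟨?_, ?_⟩
  · obtain ⟨x, hx, hxN⟩ := hex
    obtain ⟨c, rfl⟩ := KaryVertex.exists_code_eq x hx
    have hc : (fun x => (fun v => c (e.symm v)) (e x)) = c := by simp
    refine ⟨fun v => c (e.symm v), ?_, i₀, ?_⟩
    · rw [isDistinguishing_iff hG.isTree hr e he, hc]
      exact KaryVertex.distinguishing_of_good_code c hx
    · rw [hcost, hc, hxN]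
  · rintro m ⟨c, hc, i, rfl⟩
    rw [hcost]
    rw [isDistinguishing_iff hG.isTree hr e he] at hc
    exact hle i _ (KaryVertex.good_code_of_distinguishing _ hc)

end SimpleGraph

open TreeCode in
theorem theorem7 {V : Type*} [Fintype V] (G : SimpleGraph V) [DecidableRel G.Adj]
    (k n : ℕ) (hk : 2 ≤ k) (hn : 1 ≤ n) (hG : G.IsPerfectKaryTree k n) :
    (n = 1 → G.paintCost (k + 1) = k - 1) ∧
    (n = 2 → G.paintCost (k + 1) = k * (k - 1)) ∧
    (3 ≤ n → G.paintCost (k + 1) = (k - 1) * (k ^ 2 + 1) * k ^ (n - 3)) := by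
  have hC : Fintype.card (Fin (k + 1)) = k + 1 := Fintype.card_fin _
  refine ⟨?_, ?_, ?_⟩
  · rintro rfl
    obtain ⟨b, hb⟩ : ∃ b : Fin (k + 1), b ≠ 0 := ⟨Fin.last k, by
      rw [Ne, Fin.last_eq_zero_iff]; omega⟩
    exact hG.paintCost_eq hk ⟨star 0 b, star_good hC _ _, star_cost_of_ne hC hb⟩
      fun i x hx => le_cost_one (by omega) x hx
  · rintro rfl
    exact hG.paintCost_eq hk ⟨allStars 0 0, allStars_spec hC⟩
      fun i x hx => le_cost_two (by omega) x hx
  · intro h3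
    obtain ⟨j, rfl⟩ := Nat.exists_eq_add_of_le' h3
    rw [Nat.add_sub_cancel]
    exact hG.paintCost_eq (i₀ := 0) hk (many_add_three hk hC j).exists_good
      fun i x hx => le_cost_add_three hk hC j x hx
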